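/- **The $I$-function.** Let $m\le q$, $n\le p$ be non-negative integers, let $(a_i,A_i,\alpha_i)_{1\le i\le p}$, $(b_j,B_j,\beta_j)_{1\le j\le q}$ be triples with $a_i,b_j\in\mathbb C$ and real $A_i,\alpha_i,B_j,\beta_j$, and put $$\chi(s)=\frac{\prod_{i=1}^{n}\Gamma^{\alpha_i}(1-a_i-A_is)\prod_{j=1}^{m}\Gamma^{\beta_j}(b_j+B_js)}{\prod_{i=n+1}^{p}\Gamma^{\alpha_i}(a_i+A_is)\prod_{j=m+1}^{q}\Gamma^{\beta_j}(1-b_j-B_js)}.$$ Here $\Gamma^{e}=\exp(e\log\Gamma)$ with the principal branch of $\log\Gamma$ on $\mathbb C\setminus(-\infty,0]$ (the ordinary power of $\Gamma$ if $e\in\mathbb N$). For $z\neq 0$, $$I^{m,n}_{p,q}\Big[z\,\Big|\begin{matrix}(a_i,A_i,\alpha_i)_{1,p}\\(b_j,B_j,\beta_j)_{1,q}\end{matrix}\Big]=\frac1{2\pi i}\int_{C}\chi(s)z^{-s}\,ds ,$$ where $z^{-s}$ is the principal power and $C$ is a simple Lipschitz path from $c-i\infty$ to $c+i\infty$, equal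 to the line $\operatorname{Re}s=c$ outside a compact set, which is *admissible*: all singularities of $\Gamma^{\beta_j}(b_j+B_js)$, $1\le j\le m$, lie to the left of $C$ and all singularities of $\Gamma^{\alpha_i}(1-a_i-A_is)$, $1\le i\le n$, lie to the right of $C$ (when the exponent is not an integer, the branch cut issuing from the singularities is counted with them). **The I-FIG distribution.** Let $A_i,\alpha_i,B_j,\beta_j>0$, $\sigma\ge 0$, $\delta\in\mathbb C\setminus\{0\}$, and let $\alpha,a,b$ be real with $a>0,b\ge0$ if $\alpha>0$; $a\ge0,b>0$ if $\alpha<0$; $a>0,b>0$ if $\alpha=0$. Let $f_X\ge 0$ be a probability density which vanishes on $(-\infty,0]$ and satisfies $$f_X(x)=k_2\,x^{\alpha-1}e^{-ax-bx^{-1}}\,I^{m,n}_{p,q}\Big[\delta x^{\sigma}\,\Big|\begin{matrix}(a_i,A_i,\alpha_i)_{1,p}\\(b_j,B_j,\beta_j)_{1,q}\end{matrix}\Big],\qquad x>0,$$ with a constant $k_2$, where the integral over $C$ that defines this $I$-function converges absolutely. **Corollary 5.3 (Laplace transform of I-FIG).** Let $r$ be real with $a+r>0$. Assume that the path $C$ is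 admissible for the $I$-functions below as well, all $I$-functions being taken along the same path $C$; if $b=0$, assume also that $\operatorname{Re}(\alpha-\sigma s)>0$ for all $s\in C$ (which is automatic if $C$ is a vertical line). Then $e^{-rx}f_X(x)$ is integrable on $(0,\infty)$, the integrals defining the $I$-functions below converge absolutely (for the second one, if $b\ne0$), the series converges absolutely, and $\mathcal L_{f_X}(r)=\int_0^\infty e^{-rx}f_X(x)\,dx$ is given by $$\mathcal L_{f_X}(r)=k_2\sum_{l=0}^{\infty}\left\{\frac{1}{(a+r)^{\alpha}}I^{m+1,n+1}_{p+2,q+1}\Big[\frac{\delta}{(a+r)^\sigma}\Big|\begin{matrix}(1-\alpha,\sigma,1)&(a_i,A_i,\alpha_i)_{1,p}&(1+l-\alpha,\sigma,1)\\(1-\alpha,\sigma,1)&(b_j,B_j,\beta_j)_{1,q}\end{matrix}\Big]\right.$$ $$\left.-\,b^{\alpha}I^{m+1,n+1}_{p+1,q+2}\Big[b^\sigma\delta\,\Big|\begin{matrix}(1-\alpha,\sigma,1)&(a_i,A_i,\alpha_i)_{1,p}\\(1-\alpha,\sigma,1)&(b_j,B_j,\beta_j)_{1,q}&(-l-\alpha,\sigma,1)\end{matrix}\Big]\right\}\frac{((a+r)b)^l}{l!},$$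 where for $b=0$ (so that $\alpha>0$) the term with the factor $b^\alpha=0$ is read as $0$, and $0^0=1$. -/

import Mathlib

open MeasureTheory Set

noncomputable section

/-- The principal branch of `log Γ` on `ℂ ∖ (-∞, 0]` (the holomorphic branch that is real on the
positive axis), in Euler's form
`log Γ(z) = -log z + ∑_{k ≥ 1} (z log (1 + 1/k) - log (1 + z/k))`. -/
def logGamma (z : ℂ) : ℂ :=
  -Complex.log z +
    ∑' k : ℕ, (z * Complex.log (1 + 1 / ((k : ℂ) + 1)) - Complex.log (1 + z / ((k : ℂ) + 1)))

open Classical in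
/-- `Γ^e(z)` for a real exponent `e`: the ordinary power of `Γ(z)` if `e` is a natural number, and
otherwise `exp (e log Γ(z))` with the principal branch of `log Γ`. -/
def gammaPow (e : ℝ) (z : ℂ) : ℂ :=
  if ∃ k : ℕ, e = k then Complex.Gamma z ^ ⌊e⌋₊ else Complex.exp ((e : ℂ) * logGamma z)

open Classical in
/-- The singularities of `z ↦ Γ^e(z)`: the poles `0, -1, -2, …` if `e` is a natural number; otherwise
these points are branch points, and the branch cut `(-∞, 0]` issuing from them is included. -/
def gammaPowSing (e : ℝ) : Set ℂ :=
  if ∃ k : ℕ, e = k then {z | ∃ k : ℕ, z = -(k : ℂ)} else {z | z.im = 0 ∧ z.re ≤ 0}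

/-- A parameter triple `(a, A, α)` of an `I`-function. -/
structure GammaTriple where
  shift : ℂ
  scale : ℝ
  expo : ℝ

/-- The parameters of `I^{m,n}_{p,q}[ · | upper; lower]`.  The upper row `(a_i, A_i, α_i)_{1,p}` and
the lower row `(b_j, B_j, β_j)_{1,q}` are lists, so `p` and `q` are their lengths. -/
structure IParams where
  m : ℕ
  n : ℕ
  upper : List GammaTriple
  lower : List GammaTriple

/-- The restrictions `0 ≤ m ≤ q`, `0 ≤ n ≤ p`, and `A_i, α_i, B_j, β_j > 0`. -/
structure IParams.Valid (P : IParams) : Prop where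
  m_le : P.m ≤ P.lower.length
  n_le : P.n ≤ P.upper.length
  upper_pos : ∀ g ∈ P.upper, 0 < g.scale ∧ 0 < g.expo
  lower_pos : ∀ g ∈ P.lower, 0 < g.scale ∧ 0 < g.expo

/-- The Mellin–Barnes kernel
`χ(s) = ∏_{i≤n} Γ^{α_i}(1-a_i-A_i s) ∏_{j≤m} Γ^{β_j}(b_j+B_j s) /
  (∏_{i>n} Γ^{α_i}(a_i+A_i s) ∏_{j>m} Γ^{β_j}(1-b_j-B_j s))`. -/
def IParams.chi (P : IParams) (s : ℂ) : ℂ :=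
  (((P.upper.take P.n).map fun g => gammaPow g.expo (1 - g.shift - g.scale * s)).prod *
    ((P.lower.take P.m).map fun g => gammaPow g.expo (g.shift + g.scale * s)).prod) /
  (((P.upper.drop P.n).map fun g => gammaPow g.expo (g.shift + g.scale * s)).prod *
    ((P.lower.drop P.m).map fun g => gammaPow g.expo (1 - g.shift - g.scale * s)).prod)

/-- A path of integration from `c - i∞` to `c + i∞`: a simple Lipschitz curve which is the vertical
line `Re s = c` outside a compact set (in particular it can be this line itself). -/
structure MBPath where
  toFun : ℝ → ℂ
  c : ℝ
  lipschitz : ∃ K, LipschitzWith K toFun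
  injective : Function.Injective toFun
  tails : ∃ T : ℝ, ∀ t : ℝ, T ≤ |t| → toFun t = c + t * Complex.I

/-- `s` lies to the left of the path: off the path, it can be joined to a point whose real part is
smaller than that of every point of the path. -/
def MBPath.IsLeft (C : MBPath) (s : ℂ) : Prop :=
  ∃ s' : ℂ, (∀ t, s'.re < (C.toFun t).re) ∧ JoinedIn (range C.toFun)ᶜ s s'

/-- `s` lies to the right of the path. -/
def MBPath.IsRight (C : MBPath) (s : ℂ) : Prop :=
  ∃ s' : ℂ, (∀ t, (C.toFun t).re < s'.re) ∧ JoinedIn (range C.toFun)ᶜ s s'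

/-- The path has all singularities of `Γ^{β_j}(b_j + B_j s)`, `j ≤ m`, on its left and all
singularities of `Γ^{α_i}(1 - a_i - A_i s)`, `i ≤ n`, on its right. -/
structure IParams.Separates (P : IParams) (C : MBPath) : Prop where
  left : ∀ g ∈ P.lower.take P.m, ∀ s : ℂ,
    g.shift + g.scale * s ∈ gammaPowSing g.expo → C.IsLeft s
  right : ∀ g ∈ P.upper.take P.n, ∀ s : ℂ,
    1 - g.shift - g.scale * s ∈ gammaPowSing g.expo → C.IsRight s

/-- The integrand `χ(s) z^{-s} ds` in the parameter of the path. -/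
def IParams.integrand (P : IParams) (C : MBPath) (z : ℂ) (t : ℝ) : ℂ :=
  P.chi (C.toFun t) * z ^ (-(C.toFun t)) * deriv C.toFun t

/-- The integral that defines the `I`-function at `z` converges absolutely. -/
def IParams.AbsConv (P : IParams) (C : MBPath) (z : ℂ) : Prop :=
  Integrable (P.integrand C z)

/-- The `I`-function `I^{m,n}_{p,q}[z | upper; lower] = (1 / 2πi) ∫_C χ(s) z^{-s} ds`. -/
def IParams.I (P : IParams) (C : MBPath) (z : ℂ) : ℂ :=
  1 / (2 * Real.pi * Complex.I) * ∫ t, P.integrand C z t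

/-- `f` is the density of an `I`-function inverse Gaussian (I-FIG) distribution with normalizing
constant `k₂`, parameters `α, a, b, δ, σ` and `I`-function parameters `P`. -/
structure IsIFIGDensity (f : ℝ → ℝ) (k₂ : ℂ) (α a b : ℝ) (δ : ℂ) (σ : ℝ) (P : IParams)
    (C : MBPath) : Prop where
  pos_case : 0 < α → 0 < a ∧ 0 ≤ b
  neg_case : α < 0 → 0 ≤ a ∧ 0 < b
  zero_case : α = 0 → 0 < a ∧ 0 < b
  sigma_nonneg : 0 ≤ σ
  delta_ne_zero : δ ≠ 0
  valid : P.Valid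
  separates : P.Separates C
  absConv : ∀ x : ℝ, 0 < x → P.AbsConv C (δ * (x ^ σ : ℝ))
  eq_of_pos : ∀ x : ℝ, 0 < x → (f x : ℂ) =
    k₂ * (x ^ (α - 1) : ℝ) * (Real.exp (-a * x - b * x⁻¹) : ℝ) * P.I C (δ * (x ^ σ : ℝ))
  eq_zero : ∀ x : ℝ, x ≤ 0 → f x = 0
  nonneg : ∀ x : ℝ, 0 ≤ f x
  integral_eq_one : ∫ x, f x = 1

/-- The Laplace transform of a density on the positive half-line. -/
def laplaceTransform (f : ℝ → ℝ) (r : ℝ) : ℝ :=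
  ∫ x in Ioi (0 : ℝ), Real.exp (-r * x) * f x

/-- Parameters of the first `I`-function, `I^{m+1,n+1}_{p+2,q+1}` with upper row
`(1-α,σ,1), (a_i,A_i,α_i)_{1,p}, (1+l-α,σ,1)` and lower row `(1-α,σ,1), (b_j,B_j,β_j)_{1,q}`. -/
def IParams.first (P : IParams) (α σ : ℝ) (l : ℕ) : IParams where
  m := P.m + 1
  n := P.n + 1
  upper := ⟨1 - α, σ, 1⟩ :: (P.upper ++ [⟨1 + l - α, σ, 1⟩])
  lower := ⟨1 - α, σ, 1⟩ :: P.lower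

/-- Parameters of the second `I`-function, `I^{m+1,n+1}_{p+1,q+2}` with upper row
`(1-α,σ,1), (a_i,A_i,α_i)_{1,p}` and lower row `(1-α,σ,1), (b_j,B_j,β_j)_{1,q}, (-l-α,σ,1)`. -/
def IParams.second (P : IParams) (α σ : ℝ) (l : ℕ) : IParams where
  m := P.m + 1
  n := P.n + 1
  upper := ⟨1 - α, σ, 1⟩ :: P.upper
  lower := ⟨1 - α, σ, 1⟩ :: (P.lower ++ [⟨-l - α, σ, 1⟩])

/-- The `l`-th term of the series for the Laplace transform at `r`. -/
def laplaceTerm (α a b : ℝ) (δ : ℂ) (σ : ℝ) (P : IParams) (C : MBPath) (r : ℝ) (l : ℕ) : ℂ :=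
  (1 / ((a + r) ^ α : ℝ) * (P.first α σ l).I C (δ / ((a + r) ^ σ : ℝ)) -
      (b ^ α : ℝ) * (P.second α σ l).I C ((b ^ σ : ℝ) * δ)) *
    (((a + r) * b : ℝ) : ℂ) ^ l / (l.factorial : ℂ)

end

noncomputable section

/-! Insert the Mellin–Barnes integral into the Laplace integral and put `w = α - σ s`, `ρ = a + r`.
Since `Re w` stays in a bounded strip along the path, Fubini applies
(`integral_mellinBarnesKernel`), and the inner integral is `∫₀^∞ x^(w-1) e^(-ρx-b/x) dx`, a Bessel K
function. For nonintegral `w` and `b > 0` it splits into two series, with terms `ρ^(-w) Γ(w-l)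
(-ρb)^l / l!` and `b^w Γ(-w-l) (-ρb)^l / l!` (`hasSum_invGaussTerm`). That splitting is proved
directly. Cut the integral at `x = 1`; the substitution `x ↦ 1/x` turns the lower piece into an
upper one with `ρ` and `b` exchanged and `w` negated. Expanding the exponential of `1/x` gives upper
incomplete Gamma integrals, each a complete Gamma term minus a lower series (`upperGamma_eq`). The
two double series of lower terms cancel. Admissibility keeps `w` off the integers, and the straight
tails make the distance uniform: at least some `d > 0` (`exists_le_norm_sub_of_separates_first`).
Hence the `l`-th term is at most a constant times `(ρb/d)^l / l!`, so the sum commutes with the path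
integral (`hasSum_integral_invGaussTerm_mul`). Finally `Γ(w) Γ(1-w) / Γ(1+l-w) = (-1)^l Γ(w-l)`
identifies each term with the two enlarged kernels. -/

/-! ### Integrability of powers against exponentials -/

theorem integrableOn_rpow_mul_exp_neg_sub_inv {u ρ b : ℝ} (hρ : 0 < ρ)
    (hb : 0 < b ∨ b = 0 ∧ 0 < u) :
    IntegrableOn (fun x : ℝ => x ^ (u - 1) * Real.exp (-ρ * x - b * x⁻¹)) (Ioi 0) := by
  rcases hb with hb | ⟨rfl, hu⟩
  -- Near `0` the factor `e^(-b/x)` is at most `N! (x/b)^N`, which lifts the exponent `u - 1` above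
  -- `-1`.
  · obtain ⟨N, hN⟩ := exists_nat_gt (-u)
    have h := (integrableOn_rpow_mul_exp_neg_mul_rpow (p := 1) (s := u - 1 + N) (b := ρ)
      (by linarith) one_pos hρ).const_mul ((N.factorial : ℝ) / b ^ N)
    refine h.mono' (by fun_prop) ?_
    filter_upwards [self_mem_ae_restrict measurableSet_Ioi] with x hx
    have hx : 0 < x := hx
    rw [Real.norm_of_nonneg (by positivity), Real.rpow_add hx, Real.rpow_natCast, Real.rpow_one,
      sub_eq_add_neg (-ρ * x), Real.exp_add, Real.exp_neg (b * x⁻¹)]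
    have h1 := Real.pow_div_factorial_le_exp (b * x⁻¹) (by positivity) N
    have h2 : (Real.exp (b * x⁻¹))⁻¹ ≤ (N.factorial : ℝ) / b ^ N * x ^ N := by
      refine (inv_anti₀ (by positivity) h1).trans_eq ?_
      rw [mul_pow, inv_pow]
      field_simp
    calc _ = x ^ (u - 1) * Real.exp (-ρ * x) * (Real.exp (b * x⁻¹))⁻¹ := by ring
      _ ≤ x ^ (u - 1) * Real.exp (-ρ * x) * ((N.factorial : ℝ) / b ^ N * x ^ N) := by gcongr
      _ = _ := by ring
  · simpa using integrableOn_rpow_mul_exp_neg_mul_rpow (p := 1) (s := u - 1) (b := ρ)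
      (by linarith) one_pos hρ

theorem norm_cpow_mul_exp {x : ℝ} (hx : 0 < x) (w : ℂ) (y : ℝ) :
    ‖(x : ℂ) ^ (w - 1) * (Real.exp y : ℂ)‖ = x ^ (w.re - 1) * Real.exp y := by
  rw [norm_mul, Complex.norm_cpow_eq_rpow_re_of_pos hx, Complex.norm_real,
    Real.norm_of_nonneg (Real.exp_pos _).le]
  simp

theorem integrableOn_cpow_mul_exp_neg_sub_inv {w : ℂ} {ρ b : ℝ} (hρ : 0 < ρ)
    (hb : 0 < b ∨ b = 0 ∧ 0 < w.re) :
    IntegrableOn (fun x : ℝ => (x : ℂ) ^ (w - 1) * (Real.exp (-ρ * x - b * x⁻¹) : ℂ)) (Ioi 0) := by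
  refine (integrableOn_rpow_mul_exp_neg_sub_inv hρ hb).mono' (by fun_prop) ?_
  filter_upwards [self_mem_ae_restrict measurableSet_Ioi] with x hx
  exact (norm_cpow_mul_exp hx w _).le

theorem integrableOn_rpow_mul_exp_Ioi_one (u : ℝ) {ρ : ℝ} (hρ : 0 < ρ) :
    IntegrableOn (fun x : ℝ => x ^ (u - 1) * Real.exp (-ρ * x)) (Ioi 1) := by
  -- On `(1, ∞)` the extra factor `e^(-1/x)` is at least `e^(-1)`, so inserting it costs only the
  -- constant `e`.
  have h := ((integrableOn_rpow_mul_exp_neg_sub_inv (u := u) hρ (Or.inl one_pos)).mono_set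
    (Ioi_subset_Ioi zero_le_one)).const_mul (Real.exp 1)
  refine h.mono' (by fun_prop) ?_
  filter_upwards [self_mem_ae_restrict measurableSet_Ioi] with x hx
  have hx1 : 1 < x := hx
  have hx0 : 0 < x := by linarith
  rw [Real.norm_of_nonneg (by positivity), mul_left_comm, ← Real.exp_add]
  have : x⁻¹ ≤ 1 := inv_le_one_of_one_le₀ hx1.le
  gcongr
  linarith

theorem integrableOn_cpow_mul_exp_Ioi_one (w : ℂ) {ρ : ℝ} (hρ : 0 < ρ) :
    IntegrableOn (fun x : ℝ => (x : ℂ) ^ (w - 1) * (Real.exp (-ρ * x) : ℂ)) (Ioi 1) := by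
  refine (integrableOn_rpow_mul_exp_Ioi_one w.re hρ).mono' (by fun_prop) ?_
  filter_upwards [self_mem_ae_restrict measurableSet_Ioi] with x hx
  exact (norm_cpow_mul_exp (zero_lt_one.trans hx) w _).le

/-! ### Incomplete Gamma functions -/

/-- The upper incomplete Gamma integral, scaled to start at `1`. -/
def upperGamma (ρ : ℝ) (w : ℂ) : ℂ :=
  ∫ x in Ioi (1 : ℝ), (x : ℂ) ^ (w - 1) * (Real.exp (-ρ * x) : ℂ)

/-- Integration by parts: integrate the derivative of `x^w e^(-ρx)` over `(1, ∞)`. -/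
theorem upperGamma_add_one {ρ : ℝ} (hρ : 0 < ρ) {w : ℂ} (hw : w ≠ 0) :
    ρ * upperGamma ρ (w + 1) = Real.exp (-ρ) + w * upperGamma ρ w := by
  have hd : ∀ x : ℝ, 0 < x → HasDerivAt (fun x : ℝ => (x : ℂ) ^ w * (Real.exp (-ρ * x) : ℂ))
      (w * ((x : ℂ) ^ (w - 1) * (Real.exp (-ρ * x) : ℂ)) -
        ρ * ((x : ℂ) ^ (w + 1 - 1) * (Real.exp (-ρ * x) : ℂ))) x := by
    intro x hx
    have h1 := hasDerivAt_ofReal_cpow_const hx.ne' hw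
    have h2 : HasDerivAt (fun x : ℝ => (Real.exp (-ρ * x) : ℂ))
        ((Real.exp (-ρ * x) * (-ρ) : ℝ) : ℂ) x := by
      refine HasDerivAt.ofReal_comp ?_
      simpa using ((hasDerivAt_id x).const_mul (-ρ)).exp
    refine (h1.mul h2).congr_deriv ?_
    rw [add_sub_cancel_right]
    push_cast
    ring
  have i1 := (integrableOn_cpow_mul_exp_Ioi_one w hρ).const_mul w
  have i2 := (integrableOn_cpow_mul_exp_Ioi_one (w + 1) hρ).const_mul (ρ : ℂ)
  have ht : Filter.Tendsto (fun x : ℝ => (x : ℂ) ^ w * (Real.exp (-ρ * x) : ℂ)) Filter.atTop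
      (nhds 0) := by
    rw [tendsto_zero_iff_norm_tendsto_zero]
    refine (tendsto_rpow_mul_exp_neg_mul_atTop_nhds_zero w.re ρ hρ).congr' ?_
    filter_upwards [Filter.eventually_gt_atTop 0] with x hx
    have := norm_cpow_mul_exp hx (w + 1) (-ρ * x)
    simpa using this.symm
  have h := integral_Ioi_of_hasDerivAt_of_tendsto (hd 1 one_pos).continuousAt.continuousWithinAt
    (fun x hx => hd x (zero_lt_one.trans hx)) (i1.sub i2) ht
  rw [integral_sub i1 i2, integral_const_mul, integral_const_mul] at h
  simp only [upperGamma]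
  simp only [Complex.ofReal_one, Complex.one_cpow, mul_one, one_mul, zero_sub] at h
  linear_combination -h

/-- The series of the lower incomplete Gamma function, `∑ (-ρ)^k / (k! (w + k))`. -/
def lowerGammaSeries (ρ : ℝ) (w : ℂ) : ℂ :=
  ∑' k : ℕ, (-ρ : ℂ) ^ k / k.factorial / (w + k)

theorem summable_norm_pow_div_factorial (ρ : ℂ) :
    Summable fun k : ℕ => ‖ρ ^ k / (k.factorial : ℂ)‖ := by
  simpa using Real.summable_pow_div_factorial ‖ρ‖

theorem hasSum_cexp (z : ℂ) : HasSum (fun k : ℕ => z ^ k / (k.factorial : ℂ)) (Complex.exp z) := by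
  rw [Complex.exp_eq_exp_ℂ]
  exact NormedSpace.expSeries_div_hasSum_exp z

theorem norm_div_le_mul_inv {x y : ℂ} {d : ℝ} (hd : 0 < d) (h : d ≤ ‖y‖) : ‖x / y‖ ≤ ‖x‖ * d⁻¹ := by
  rw [norm_div, div_eq_mul_inv]
  gcongr

theorem hasSum_lowerGammaSeries (ρ : ℝ) {w : ℂ} {d : ℝ} (hd : 0 < d)
    (hw : ∀ n : ℕ, d ≤ ‖w + n‖) :
    HasSum (fun k : ℕ => (-ρ : ℂ) ^ k / k.factorial / (w + k)) (lowerGammaSeries ρ w) :=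
  (Summable.of_norm_bounded ((summable_norm_pow_div_factorial (-ρ : ℂ)).mul_right d⁻¹)
    fun k => norm_div_le_mul_inv hd (hw k)).hasSum

/-- Subtract the exponential series termwise: `w/(w+k) - 1 = -k/(w+k)` kills the term `k = 0`, and
the rest is the shifted series. -/
theorem lowerGammaSeries_add_one (ρ : ℝ) {w : ℂ} {d : ℝ} (hd : 0 < d)
    (hw : ∀ n : ℕ, d ≤ ‖w + n‖) :
    ρ * lowerGammaSeries ρ (w + 1) = w * lowerGammaSeries ρ w - Real.exp (-ρ) := by
  have hw1 : ∀ n : ℕ, d ≤ ‖w + 1 + n‖ := fun n => by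
    simpa [add_assoc, add_comm, add_left_comm] using hw (n + 1)
  have hne : ∀ n : ℕ, w + n ≠ 0 := fun n h => by
    have := hw n
    rw [h, norm_zero] at this
    linarith
  have h0 := (hasSum_lowerGammaSeries ρ hd hw).mul_left w
  have h1 := (hasSum_lowerGammaSeries ρ hd hw1).mul_left (ρ : ℂ)
  have h2 := h0.sub (hasSum_cexp (-ρ : ℂ))
  have h3 := (hasSum_nat_add_iff' 1).mpr h2
  have hw0 : w ≠ 0 := by simpa using hne 0
  simp only [Finset.range_one, Finset.sum_singleton, pow_zero, Nat.factorial_zero, Nat.cast_one,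
    div_one, Nat.cast_zero, add_zero, mul_one_div_cancel hw0, sub_self, sub_zero] at h3
  push_cast
  refine h1.unique (h3.congr_fun ?_)
  intro k
  have a1 := hne (k + 1)
  have a2 : (k.factorial : ℂ) ≠ 0 := by exact_mod_cast k.factorial_ne_zero
  have a3 : (k : ℂ) + 1 ≠ 0 := by exact_mod_cast k.succ_ne_zero
  have a4 : w + 1 + k ≠ 0 := by
    push_cast at a1
    rwa [add_assoc, add_comm (1 : ℂ)]
  rw [show w + ((k + 1 : ℕ) : ℂ) = w + 1 + k by push_cast; ring, Nat.factorial_succ]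
  push_cast
  field_simp
  ring

/-- Here Euler's integral over `(0, ∞)` converges; its part over `(0, 1]` is integrated termwise
after expanding `e^(-ρx)`. -/
theorem upperGamma_of_re_pos {ρ : ℝ} (hρ : 0 < ρ) {w : ℂ} (hw : 0 < w.re) :
    upperGamma ρ w = (ρ : ℂ) ^ (-w) * Complex.Gamma w - lowerGammaSeries ρ w := by
  have hG := Complex.integral_cpow_mul_exp_neg_mul_Ioi hw hρ
  rw [one_div, Complex.inv_cpow_ofReal_nonneg hρ.le, ← Complex.cpow_neg] at hG
  have hexp : ∀ x : ℝ, Complex.exp (-((ρ : ℂ) * x)) = (Real.exp (-ρ * x) : ℂ) := fun x => by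
    push_cast
    rw [neg_mul]
  simp only [hexp] at hG
  have hI : IntegrableOn (fun x : ℝ => (x : ℂ) ^ (w - 1) * (Real.exp (-ρ * x) : ℂ)) (Ioi 0) := by
    simpa using integrableOn_cpow_mul_exp_neg_sub_inv (b := 0) hρ (Or.inr ⟨rfl, hw⟩)
  rw [← Ioc_union_Ioi_eq_Ioi zero_le_one, setIntegral_union Ioc_disjoint_Ioi_same
    measurableSet_Ioi (hI.mono_set Ioc_subset_Ioi_self)
    (hI.mono_set (Ioi_subset_Ioi zero_le_one))] at hG
  suffices h : ∫ x in Ioc (0 : ℝ) 1, (x : ℂ) ^ (w - 1) * (Real.exp (-ρ * x) : ℂ) =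
      lowerGammaSeries ρ w by
    rw [h] at hG
    rw [upperGamma]
    linear_combination hG
  set F : ℕ → ℝ → ℂ := fun k x => (-ρ : ℂ) ^ k / k.factorial * (x : ℂ) ^ (w - 1 + k) with hF
  have hwk : ∀ k : ℕ, -1 < (w - 1 + k).re := fun k => by
    simp only [Complex.add_re, Complex.sub_re, Complex.one_re, Complex.natCast_re]
    linarith [k.cast_nonneg (α := ℝ)]
  have hFi : ∀ k, IntegrableOn (F k) (Ioc 0 1) := fun k =>
    ((intervalIntegrable_iff_integrableOn_Ioc_of_le zero_le_one).mp
      (intervalIntegral.intervalIntegrable_cpow' (hwk k))).const_mul _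
  have hFv : ∀ k, ∫ x in Ioc (0 : ℝ) 1, F k x = (-ρ : ℂ) ^ k / k.factorial / (w + k) := by
    intro k
    have hne : w - 1 + k + 1 ≠ 0 := fun h => by
      have := congrArg Complex.re h
      have h2 := hwk k
      simp only [Complex.add_re, Complex.one_re, Complex.zero_re] at this h2
      linarith
    rw [hF, integral_const_mul, ← intervalIntegral.integral_of_le zero_le_one,
      integral_cpow (Or.inl (hwk k)), Complex.ofReal_zero, Complex.zero_cpow hne,
      Complex.ofReal_one, Complex.one_cpow, sub_zero, mul_one_div]
    congr 1
    ring
  have hsum : Summable fun k => ∫ x in Ioc (0 : ℝ) 1, ‖F k x‖ := by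
    refine Summable.of_nonneg_of_le (fun k => by positivity) (fun k => ?_)
      ((summable_norm_pow_div_factorial (-ρ : ℂ)).mul_right
        (∫ x in Ioc (0 : ℝ) 1, ‖(x : ℂ) ^ (w - 1 + (0 : ℕ))‖))
    rw [← integral_const_mul]
    refine setIntegral_mono_on (hFi k).norm ?_ measurableSet_Ioc fun x hx => ?_
    · exact ((intervalIntegrable_iff_integrableOn_Ioc_of_le zero_le_one).mp
        (intervalIntegral.intervalIntegrable_cpow' (hwk 0))).norm.const_mul _
    · rw [hF, norm_mul, Complex.norm_cpow_eq_rpow_re_of_pos hx.1,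
        Complex.norm_cpow_eq_rpow_re_of_pos hx.1]
      refine mul_le_mul_of_nonneg_left ?_ (norm_nonneg _)
      exact Real.rpow_le_rpow_of_exponent_ge hx.1 hx.2 (by simp)
  have key := hasSum_integral_of_summable_integral_norm hFi hsum
  simp only [hFv] at key
  rw [lowerGammaSeries, key.tsum_eq]
  refine setIntegral_congr_fun measurableSet_Ioc fun x hx => ?_
  have hx0 : (x : ℂ) ≠ 0 := by exact_mod_cast hx.1.ne'
  have := (hasSum_cexp (-ρ * x : ℂ)).mul_left ((x : ℂ) ^ (w - 1))
  push_cast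
  refine (this.congr_fun fun k => ?_).tsum_eq.symm
  rw [hF]
  simp only
  rw [Complex.cpow_add _ _ hx0, Complex.cpow_natCast]
  ring

/-- Both sides obey the same recurrence in `w ↦ w + 1`, so the identity descends from the half-plane
`Re w > 0` one unit at a time; `w` must avoid `0, -1, -2, …`. -/
theorem upperGamma_eq {ρ : ℝ} (hρ : 0 < ρ) {w : ℂ} {d : ℝ} (hd : 0 < d)
    (hw : ∀ n : ℕ, d ≤ ‖w + n‖) :
    upperGamma ρ w = (ρ : ℂ) ^ (-w) * Complex.Gamma w - lowerGammaSeries ρ w := by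
  obtain ⟨N, hN⟩ := exists_nat_gt (-w.re)
  induction N generalizing w with
  | zero => exact upperGamma_of_re_pos hρ (by simpa using hN)
  | succ N ih =>
    have hw0 : w ≠ 0 := by
      rintro rfl
      have := hw 0
      simp at this
      linarith
    have hρ0 : (ρ : ℂ) ≠ 0 := by exact_mod_cast hρ.ne'
    have h := ih (w := w + 1) (fun n => by
      simpa [add_assoc, add_comm, add_left_comm] using hw (n + 1)) (by
        push_cast at hN
        simp only [Complex.add_re, Complex.one_re]
        linarith)
    have h1 := upperGamma_add_one hρ hw0
    have h2 := lowerGammaSeries_add_one ρ hd hw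
    rw [h, Complex.Gamma_add_one w hw0, neg_add, Complex.cpow_add _ _ hρ0, Complex.cpow_neg_one]
      at h1
    refine mul_left_cancel₀ hw0 ?_
    field_simp at h1
    linear_combination -h1 - h2

/-! ### Series expansion of the inverse Gaussian integral -/

/-- The part over `(1, ∞)` of the integral `invGaussIntegral`. -/
def invGaussTail (ρ b : ℝ) (w : ℂ) : ℂ :=
  ∫ x in Ioi (1 : ℝ), (x : ℂ) ^ (w - 1) * (Real.exp (-ρ * x - b * x⁻¹) : ℂ)

/-- The integral `∫₀^∞ x^{w-1} e^{-ρx-b/x} dx`, a multiple of a modified Bessel function. -/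
def invGaussIntegral (ρ b : ℝ) (w : ℂ) : ℂ :=
  ∫ x in Ioi (0 : ℝ), (x : ℂ) ^ (w - 1) * (Real.exp (-ρ * x - b * x⁻¹) : ℂ)

/-- Expand `e^(-b/x)`; since `x^(-l) ≤ 1` on `(1, ∞)`, the integrals of the norms are dominated by
the exponential series. -/
theorem hasSum_invGaussTail {ρ : ℝ} (hρ : 0 < ρ) (b : ℝ) (w : ℂ) :
    HasSum (fun l : ℕ => (-b : ℂ) ^ l / l.factorial * upperGamma ρ (w - l))
      (invGaussTail ρ b w) := by
  set F : ℕ → ℝ → ℂ := fun l x =>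
    (-b : ℂ) ^ l / l.factorial * ((x : ℂ) ^ (w - l - 1) * (Real.exp (-ρ * x) : ℂ)) with hF
  have hFi : ∀ l, IntegrableOn (F l) (Ioi 1) := fun l =>
    (integrableOn_cpow_mul_exp_Ioi_one (w - l) hρ).const_mul _
  have hFv : ∀ l, ∫ x in Ioi (1 : ℝ), F l x =
      (-b : ℂ) ^ l / l.factorial * upperGamma ρ (w - l) := fun l => integral_const_mul _ _
  have hsum : Summable fun l => ∫ x in Ioi (1 : ℝ), ‖F l x‖ := by
    refine Summable.of_nonneg_of_le (fun k => by positivity) (fun k => ?_)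
      ((summable_norm_pow_div_factorial (-b : ℂ)).mul_right
        (∫ x in Ioi (1 : ℝ), x ^ (w.re - 1) * Real.exp (-ρ * x)))
    rw [← integral_const_mul]
    refine setIntegral_mono_on (hFi k).norm
      ((integrableOn_rpow_mul_exp_Ioi_one w.re hρ).const_mul _) measurableSet_Ioi fun x hx => ?_
    have hx1 : 1 < x := hx
    have hx0 : 0 < x := zero_lt_one.trans hx1
    rw [hF, norm_mul, norm_cpow_mul_exp hx0]
    have : x ^ ((w - k).re - 1) ≤ x ^ (w.re - 1) :=
      Real.rpow_le_rpow_of_exponent_le hx1.le (by simp)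
    gcongr
  have key := hasSum_integral_of_summable_integral_norm hFi hsum
  simp only [hFv] at key
  suffices h : ∫ x in Ioi (1 : ℝ), ∑' l, F l x = invGaussTail ρ b w by rwa [h] at key
  symm
  refine setIntegral_congr_fun measurableSet_Ioi fun x hx => ?_
  have hx1 : 0 < x := lt_trans one_pos hx
  have hx0 : (x : ℂ) ≠ 0 := by exact_mod_cast hx1.ne'
  have := (hasSum_cexp (-b * (x : ℂ)⁻¹)).mul_left
    ((x : ℂ) ^ (w - 1) * (Real.exp (-ρ * x) : ℂ))
  have he : (x : ℂ) ^ (w - 1) * (Real.exp (-ρ * x - b * x⁻¹) : ℂ) =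
      (x : ℂ) ^ (w - 1) * (Real.exp (-ρ * x) : ℂ) * Complex.exp (-b * (x : ℂ)⁻¹) := by
    push_cast
    rw [mul_assoc, ← Complex.exp_add, neg_mul (b : ℂ), ← sub_eq_add_neg]
  simp only [he]
  refine (this.congr_fun fun k => ?_).tsum_eq.symm
  rw [hF]
  simp only
  rw [show w - k - 1 = w - 1 - k by ring, Complex.cpow_sub _ _ hx0, Complex.cpow_natCast, mul_pow,
    inv_pow]
  ring

theorem invGaussTail_comp_inv (ρ b : ℝ) (w : ℂ) :
    ∫ x in Ioo (0 : ℝ) 1, (x : ℂ) ^ (w - 1) * (Real.exp (-ρ * x - b * x⁻¹) : ℂ) =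
      invGaussTail b ρ (-w) := by
  have h := integral_comp_rpow_Ioi ((Ioi (1 : ℝ)).indicator fun x : ℝ =>
    (x : ℂ) ^ (-w - 1) * (Real.exp (-b * x - ρ * x⁻¹) : ℂ)) (p := -1) (by norm_num)
  rw [setIntegral_indicator measurableSet_Ioi,
    inter_eq_self_of_subset_right (Ioi_subset_Ioi zero_le_one)] at h
  have hs : Ioo (0 : ℝ) 1 = Ioi 0 ∩ Ioo 0 1 :=
    (inter_eq_self_of_subset_right Ioo_subset_Ioi_self).symm
  rw [invGaussTail, ← h, hs, ← setIntegral_indicator measurableSet_Ioo]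
  refine setIntegral_congr_fun measurableSet_Ioi fun x hx => ?_
  have hx : 0 < x := hx
  have hx0 : (x : ℂ) ≠ 0 := by exact_mod_cast hx.ne'
  simp only [indicator, mem_Ioo, mem_Ioi, Real.rpow_neg_one, one_lt_inv₀ hx, hx, true_and]
  split_ifs with h1
  · rw [Complex.real_smul, Complex.ofReal_inv, Complex.inv_cpow_ofReal_nonneg hx.le,
      ← Complex.cpow_neg, inv_inv, show -b * x⁻¹ - ρ * x = -ρ * x - b * x⁻¹ by ring, ← mul_assoc]
    congr 1
    rw [show -(-w - 1) = w - 1 + 2 by ring, Complex.cpow_add _ _ hx0, abs_neg, abs_one, one_mul,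
      show (-1 - 1 : ℝ) = -((2 : ℕ) : ℝ) by norm_num, Real.rpow_neg hx.le, Real.rpow_natCast]
    rw [show (2 : ℂ) = ((2 : ℕ) : ℂ) by norm_num, Complex.cpow_natCast]
    push_cast
    field_simp
  · simp

theorem invGaussIntegral_eq_add {ρ b : ℝ} (hρ : 0 < ρ) (hb : 0 < b) (w : ℂ) :
    invGaussIntegral ρ b w = invGaussTail b ρ (-w) + invGaussTail ρ b w := by
  have hI := integrableOn_cpow_mul_exp_neg_sub_inv (w := w) hρ (Or.inl hb)
  rw [invGaussIntegral, ← Ioc_union_Ioi_eq_Ioi zero_le_one, setIntegral_union Ioc_disjoint_Ioi_same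
    measurableSet_Ioi (hI.mono_set Ioc_subset_Ioi_self)
    (hI.mono_set (Ioi_subset_Ioi zero_le_one)), integral_Ioc_eq_integral_Ioo,
    invGaussTail_comp_inv]
  rfl

/-- Each denominator is `w` minus an integer, of norm at least `d`, so a product of two exponential
series dominates. -/
theorem summable_invGauss_double {ρ b : ℝ} {w : ℂ} {d : ℝ} (hd : 0 < d)
    (hw : ∀ n : ℤ, d ≤ ‖w - n‖) :
    Summable (Function.uncurry fun l k : ℕ =>
      (-b : ℂ) ^ l / l.factorial * ((-ρ : ℂ) ^ k / k.factorial / (w - l + k))) := by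
  refine Summable.of_norm_bounded (((summable_norm_pow_div_factorial (-b : ℂ)).mul_of_nonneg
    (summable_norm_pow_div_factorial (-ρ : ℂ)) (fun _ => norm_nonneg _)
    (fun _ => norm_nonneg _)).mul_right d⁻¹) fun ⟨l, k⟩ => ?_
  simp only [Function.uncurry_apply_pair]
  rw [← mul_div_assoc, ← norm_mul]
  refine norm_div_le_mul_inv hd ?_
  have := hw (l - k)
  push_cast at this
  rwa [sub_sub_eq_add_sub, add_sub_right_comm] at this

/-- After exchanging the summation indices, allowed by absolute summability, the terms are opposite
because `w - l + k = -(-w - k + l)`. -/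
theorem lowerGammaSeries_double_cancel {ρ b : ℝ} {w : ℂ} {d : ℝ} (hd : 0 < d)
    (hw : ∀ n : ℤ, d ≤ ‖w - n‖) :
    ∑' l : ℕ, (-b : ℂ) ^ l / l.factorial * lowerGammaSeries ρ (w - l) +
      ∑' l : ℕ, (-ρ : ℂ) ^ l / l.factorial * lowerGammaSeries b (-w - l) = 0 := by
  simp only [lowerGammaSeries, ← tsum_mul_left]
  rw [(summable_invGauss_double (ρ := ρ) (b := b) hd hw).tsum_comm.symm, ← eq_neg_iff_add_eq_zero,
    ← tsum_neg]
  refine tsum_congr fun l => ?_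
  rw [← tsum_neg]
  refine tsum_congr fun k => ?_
  rw [show w - k + l = -(-w - l + k) by ring, div_neg]
  ring

theorem summable_mul_lowerGammaSeries {ρ b : ℝ} {w : ℂ} {d : ℝ} (hd : 0 < d)
    (hw : ∀ n : ℤ, d ≤ ‖w - n‖) :
    Summable fun l : ℕ => (-b : ℂ) ^ l / l.factorial * lowerGammaSeries ρ (w - l) := by
  simp only [lowerGammaSeries, ← tsum_mul_left]
  exact (summable_invGauss_double (ρ := ρ) (b := b) hd hw).prod

theorem hasSum_invGaussTail_add {ρ : ℝ} (hρ : 0 < ρ) (b : ℝ) {w : ℂ} {d : ℝ} (hd : 0 < d)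
    (hw : ∀ n : ℤ, d ≤ ‖w - n‖) :
    HasSum (fun l : ℕ => (-b : ℂ) ^ l / l.factorial *
        ((ρ : ℂ) ^ (-(w - l)) * Complex.Gamma (w - l)))
      (invGaussTail ρ b w +
        ∑' l : ℕ, (-b : ℂ) ^ l / l.factorial * lowerGammaSeries ρ (w - l)) := by
  refine ((hasSum_invGaussTail hρ b w).add
    (summable_mul_lowerGammaSeries (ρ := ρ) (b := b) hd hw).hasSum).congr_fun fun l => ?_
  rw [upperGamma_eq hρ hd (fun n => ?_)]
  · ring
  · have := hw (l - n)
    push_cast at this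
    rwa [sub_sub_eq_add_sub, add_sub_right_comm] at this

/-! ### Gamma quotients and the two-series expansion -/

/-- The quotient `Γ(w) Γ(1 - w) / Γ(1 + l - w) = Γ(w) / (1 - w)_l`. -/
def gammaRatio (l : ℕ) (w : ℂ) : ℂ :=
  Complex.Gamma w * Complex.Gamma (1 - w) / Complex.Gamma (1 + l - w)

theorem gammaRatio_eq {w : ℂ} (hw : ∀ n : ℤ, w ≠ n) (l : ℕ) :
    gammaRatio l w = (-1) ^ l * Complex.Gamma (w - l) := by
  have hne : ∀ k : ℕ, Complex.Gamma (1 + k - w) ≠ 0 := fun k =>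
    Complex.Gamma_ne_zero fun m h => hw (1 + k + m) (by
      push_cast
      linear_combination -h)
  have hne' : ∀ k : ℕ, w - (k + 1) ≠ 0 := fun k h => hw (k + 1) (by
    push_cast
    linear_combination h)
  unfold gammaRatio
  rw [div_eq_iff (hne l)]
  induction l with
  | zero => simp
  | succ l ih =>
    have h1 := Complex.Gamma_add_one _ (hne' l)
    have h2 := Complex.Gamma_add_one (1 + l - w) (fun h => hne' l (by linear_combination -h))
    rw [show w - (l + 1) + 1 = w - l by ring] at h1
    rw [show 1 + l - w + 1 = 1 + (l + 1) - w by ring] at h2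
    push_cast
    rw [ih, h1, h2, pow_succ]
    ring

theorem gammaRatio_zero {w : ℂ} (hw : ∀ n : ℤ, w ≠ n) : gammaRatio 0 w = Complex.Gamma w := by
  simp [gammaRatio_eq hw]

theorem ne_intCast_of_le_norm_sub {w : ℂ} {d : ℝ} (hd : 0 < d) (hw : ∀ n : ℤ, d ≤ ‖w - n‖)
    (n : ℤ) : w ≠ n := by
  rintro rfl
  have := hw n
  rw [sub_self, norm_zero] at this
  linarith

theorem le_norm_neg_sub {w : ℂ} {d : ℝ} (hw : ∀ n : ℤ, d ≤ ‖w - n‖) (n : ℤ) :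
    d ≤ ‖-w - n‖ := by
  have : -w - n = -(w - (-n : ℤ)) := by
    push_cast
    ring
  rw [this, norm_neg]
  exact hw (-n)

/-- Each step from `Γ(w-l)` to `Γ(w-l-1)` divides by a number of norm at least `d`. -/
theorem norm_gammaRatio_le {w : ℂ} {d : ℝ} (hd : 0 < d) (hw : ∀ n : ℤ, d ≤ ‖w - n‖) (l : ℕ) :
    ‖gammaRatio l w‖ ≤ ‖Complex.Gamma w‖ * d⁻¹ ^ l := by
  have hne := ne_intCast_of_le_norm_sub hd hw
  rw [gammaRatio_eq hne, norm_mul, norm_pow, norm_neg, norm_one, one_pow, one_mul]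
  induction l with
  | zero => simp
  | succ l ih =>
    have h0 : w - (l + 1) ≠ 0 := fun h => hne (l + 1) (by
      push_cast
      linear_combination h)
    have h1 := Complex.Gamma_add_one _ h0
    have h2 := hw (l + 1)
    push_cast at h2 ⊢
    rw [show w - (l + 1) + 1 = w - l by ring] at h1
    rw [h1, norm_mul] at ih
    have h3 : ‖Complex.Gamma (w - (l + 1))‖ =
        (‖w - (l + 1)‖ * ‖Complex.Gamma (w - (l + 1))‖) * ‖w - (l + 1)‖⁻¹ := by
      have := norm_ne_zero_iff.mpr h0
      field_simp
    rw [h3, pow_succ, ← mul_assoc]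
    gcongr

/-- The terms of the expansion of `invGaussIntegral` in powers of `ρ b`. -/
def invGaussTerm (ρ b : ℝ) (l : ℕ) (w : ℂ) : ℂ :=
  ((ρ : ℂ) ^ (-w) * gammaRatio l w + (b : ℂ) ^ w * gammaRatio l (-w)) *
    (ρ * b : ℂ) ^ l / l.factorial

theorem hasSum_invGaussTerm_of_pos {ρ b : ℝ} (hρ : 0 < ρ) (hb : 0 < b) {w : ℂ} {d : ℝ}
    (hd : 0 < d) (hw : ∀ n : ℤ, d ≤ ‖w - n‖) :
    HasSum (fun l => invGaussTerm ρ b l w) (invGaussIntegral ρ b w) := by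
  have hw' := le_norm_neg_sub hw
  have h := (hasSum_invGaussTail_add hρ b hd hw).add (hasSum_invGaussTail_add hb ρ hd hw')
  have hc := lowerGammaSeries_double_cancel (ρ := ρ) (b := b) hd hw
  have hρ0 : (ρ : ℂ) ≠ 0 := by exact_mod_cast hρ.ne'
  have hb0 : (b : ℂ) ≠ 0 := by exact_mod_cast hb.ne'
  convert h using 1
  · funext l
    rw [invGaussTerm, gammaRatio_eq (ne_intCast_of_le_norm_sub hd hw),
      gammaRatio_eq (ne_intCast_of_le_norm_sub hd hw'), neg_sub', sub_neg_eq_add, neg_sub',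
      sub_neg_eq_add, neg_neg, Complex.cpow_add _ _ hρ0, Complex.cpow_add _ _ hb0,
      Complex.cpow_natCast, Complex.cpow_natCast, neg_pow (b : ℂ), neg_pow (ρ : ℂ), mul_pow]
    ring
  · rw [invGaussIntegral_eq_add hρ hb]
    linear_combination -hc

/-- For `b = 0` only `l = 0` survives, `0^w` vanishes, and Euler's integral remains. -/
theorem hasSum_invGaussTerm_of_eq_zero {ρ : ℝ} (hρ : 0 < ρ) {w : ℂ} (hw : ∀ n : ℤ, w ≠ n)
    (hre : 0 < w.re) : HasSum (fun l => invGaussTerm ρ 0 l w) (invGaussIntegral ρ 0 w) := by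
  have hw0 : w ≠ 0 := by simpa using hw 0
  convert hasSum_single (f := fun l => invGaussTerm ρ 0 l w) 0 (fun l hl => ?_) using 1
  · have hG := Complex.integral_cpow_mul_exp_neg_mul_Ioi hre hρ
    rw [one_div, Complex.inv_cpow_ofReal_nonneg hρ.le, ← Complex.cpow_neg] at hG
    simp only [invGaussTerm, gammaRatio_zero hw, Complex.ofReal_zero, Complex.zero_cpow hw0,
      zero_mul, add_zero, pow_zero, mul_one, Nat.factorial_zero, Nat.cast_one, div_one]
    rw [← hG, invGaussIntegral]
    simp
  · simp [invGaussTerm, hl]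

theorem hasSum_invGaussTerm {ρ b : ℝ} (hρ : 0 < ρ) {w : ℂ} (hb : 0 < b ∨ b = 0 ∧ 0 < w.re) {d : ℝ}
    (hd : 0 < d) (hw : ∀ n : ℤ, d ≤ ‖w - n‖) :
    HasSum (fun l => invGaussTerm ρ b l w) (invGaussIntegral ρ b w) := by
  rcases hb with hb | ⟨rfl, hre⟩
  · exact hasSum_invGaussTerm_of_pos hρ hb hd hw
  · exact hasSum_invGaussTerm_of_eq_zero hρ (ne_intCast_of_le_norm_sub hd hw) hre

/-! ### Fubini and termwise integration on a vertical strip -/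

theorem rpow_le_rpow_add_rpow {x u v y : ℝ} (hx : 0 < x) (hu : u ≤ y) (hv : y ≤ v) :
    x ^ y ≤ x ^ u + x ^ v := by
  rcases le_total x 1 with h | h
  · have := Real.rpow_le_rpow_of_exponent_ge hx h hu
    linarith [Real.rpow_nonneg hx.le v]
  · have := Real.rpow_le_rpow_of_exponent_le h hv
    linarith [Real.rpow_nonneg hx.le u]

/-- The double integrand behind the Laplace transform of a Mellin–Barnes density. -/
def mellinBarnesKernel (ρ b : ℝ) (g ν : ℝ → ℂ) (x t : ℝ) : ℂ :=
  ((x : ℂ) ^ (ν t - 1) * (Real.exp (-ρ * x - b * x⁻¹) : ℂ)) * g t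

section

variable {ρ b u v : ℝ} {g ν : ℝ → ℂ}

/-- On the strip `u ≤ Re w ≤ v` the power of `x` is dominated by its two edge values, which leaves a
product of a function of `x` and one of `t`. -/
theorem integrable_mellinBarnesKernel (hρ : 0 < ρ) (hb : 0 < b ∨ b = 0 ∧ 0 < u)
    (hg : Integrable g) (hν : Continuous ν) (hu : ∀ t, u ≤ (ν t).re) (hv : ∀ t, (ν t).re ≤ v) :
    Integrable (Function.uncurry (mellinBarnesKernel ρ b g ν))
      ((volume.restrict (Ioi 0)).prod volume) := by
  have huv : u ≤ v := (hu 0).trans (hv 0)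
  have hφ := (integrableOn_rpow_mul_exp_neg_sub_inv hρ hb).add
    (integrableOn_rpow_mul_exp_neg_sub_inv (u := v) hρ
      (hb.imp_right fun h => ⟨h.1, h.2.trans_le huv⟩))
  refine (hφ.mul_prod hg.norm).mono' ?_ ?_
  · refine AEStronglyMeasurable.mul (Measurable.aestronglyMeasurable ?_) hg.1.comp_snd
    have := hν.measurable
    fun_prop
  · have h1 : ∀ᵐ p : ℝ × ℝ ∂((volume.restrict (Ioi 0)).prod volume), 0 < p.1 :=
      Measure.quasiMeasurePreserving_fst.ae (self_mem_ae_restrict measurableSet_Ioi)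
    filter_upwards [h1] with p hp
    simp only [Function.uncurry, mellinBarnesKernel, norm_mul _ (g p.2), norm_cpow_mul_exp hp,
      Pi.add_apply]
    rw [← add_mul]
    gcongr
    exact rpow_le_rpow_add_rpow hp (by linarith [hu p.2]) (by linarith [hv p.2])

theorem integral_mellinBarnesKernel (hρ : 0 < ρ) (hb : 0 < b ∨ b = 0 ∧ 0 < u)
    (hg : Integrable g) (hν : Continuous ν) (hu : ∀ t, u ≤ (ν t).re) (hv : ∀ t, (ν t).re ≤ v) :
    ∫ x in Ioi (0 : ℝ), ∫ t, mellinBarnesKernel ρ b g ν x t =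
      ∫ t, invGaussIntegral ρ b (ν t) * g t := by
  rw [integral_integral_swap (integrable_mellinBarnesKernel hρ hb hg hν hu hv)]
  simp only [mellinBarnesKernel, integral_mul_const, invGaussIntegral]

end

theorem norm_Gamma_le_Gamma_re {w : ℂ} (hw : 0 < w.re) :
    ‖Complex.Gamma w‖ ≤ Real.Gamma w.re := by
  rw [Complex.Gamma_eq_integral hw, Real.Gamma_eq_integral hw, Complex.GammaIntegral]
  refine (norm_integral_le_integral_norm _).trans_eq ?_
  refine setIntegral_congr_fun measurableSet_Ioi fun x hx => ?_
  rw [mul_comm, norm_cpow_mul_exp hx, mul_comm]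

/-- Shift the strip by `N` into the right half-plane, where `|Γ(w)| ≤ Γ(Re w)` is bounded by
compactness; shifting back costs at most `d⁻¹ ^ N`. -/
theorem exists_norm_Gamma_le (u v : ℝ) {d : ℝ} (hd : 0 < d) :
    ∃ B, 0 ≤ B ∧ ∀ w : ℂ, u ≤ w.re → w.re ≤ v → (∀ n : ℤ, d ≤ ‖w - n‖) →
      ‖Complex.Gamma w‖ ≤ B := by
  obtain ⟨N, hN⟩ := exists_nat_gt (-u)
  have hc : ContinuousOn Real.Gamma (Icc (u + N) (v + N)) := fun x hx =>
    (Real.differentiableAt_Gamma (fun m h => by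
      have := hx.1
      have hm := m.cast_nonneg (α := ℝ)
      linarith)).continuousAt.continuousWithinAt
  obtain ⟨B, hB⟩ := isCompact_Icc.exists_bound_of_continuousOn hc
  refine ⟨max B 0 * d⁻¹ ^ N, by positivity, fun w hu hv hw => ?_⟩
  have hw' : ∀ n : ℤ, d ≤ ‖w + N - n‖ := fun n => by
    have := hw (n - N)
    push_cast at this
    rwa [sub_sub_eq_add_sub] at this
  have h := norm_gammaRatio_le hd hw' N
  rw [gammaRatio_eq (ne_intCast_of_le_norm_sub hd hw'), norm_mul, norm_pow, norm_neg, norm_one,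
    one_pow, one_mul, add_sub_cancel_right] at h
  refine h.trans ?_
  gcongr
  have hre : (w + N).re = w.re + N := by simp
  refine (norm_Gamma_le_Gamma_re (by rw [hre]; linarith)).trans ?_
  rw [hre]
  exact ((le_abs_self _).trans (hB _ ⟨by linarith, by linarith⟩)).trans (le_max_left _ _)

theorem exists_norm_cpow_mul_gammaRatio_le {ρ : ℝ} (hρ : 0 ≤ ρ) (u v : ℝ) {d : ℝ} (hd : 0 < d) :
    ∃ B, 0 ≤ B ∧ ∀ (l : ℕ) (w : ℂ), u ≤ w.re → w.re ≤ v → (∀ n : ℤ, d ≤ ‖w - n‖) →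
      ‖(ρ : ℂ) ^ (-w) * gammaRatio l w‖ ≤ B * d⁻¹ ^ l := by
  obtain ⟨B, hB0, hB⟩ := exists_norm_Gamma_le u v hd
  refine ⟨(ρ ^ (-v) + ρ ^ (-u)) * B, by positivity, fun l w hu hv hw => ?_⟩
  rw [norm_mul, mul_assoc]
  have h1 : ‖(ρ : ℂ) ^ (-w)‖ ≤ ρ ^ (-v) + ρ ^ (-u) := by
    -- The value `0` must be covered because this bound is also applied with `b` in place of `ρ`;
    -- then `0^(-w) = 0` as `w ≠ 0`.
    rcases hρ.eq_or_lt with rfl | hρ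
    · have : w ≠ 0 := by simpa using ne_intCast_of_le_norm_sub hd hw 0
      rw [Complex.ofReal_zero, Complex.zero_cpow (neg_ne_zero.mpr this), norm_zero]
      positivity
    · rw [Complex.norm_cpow_eq_rpow_re_of_pos hρ, Complex.neg_re]
      exact rpow_le_rpow_add_rpow hρ (by linarith) (by linarith)
  have h2 := (norm_gammaRatio_le hd hw l).trans
    (mul_le_mul_of_nonneg_right (hB w hu hv hw) (by positivity))
  gcongr

section

variable {ρ b u v d : ℝ} {g ν : ℝ → ℂ}

theorem continuous_gammaRatio_comp (hd : 0 < d) (hν : Continuous ν)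
    (hw : ∀ t, ∀ n : ℤ, d ≤ ‖ν t - n‖) (l : ℕ) : Continuous fun t => gammaRatio l (ν t) := by
  simp only [fun t => gammaRatio_eq (ne_intCast_of_le_norm_sub hd (hw t)) l]
  refine continuous_const.mul (continuous_iff_continuousAt.mpr fun t => ?_)
  refine ContinuousAt.comp (f := fun t => ν t - l) (g := Complex.Gamma) ?_
    (hν.sub continuous_const).continuousAt
  refine (Complex.differentiableAt_Gamma _ fun m h => ?_).continuousAt
  refine ne_intCast_of_le_norm_sub hd (hw t) (l - m) ?_
  push_cast
  linear_combination h

theorem integrable_cpow_mul_gammaRatio_mul (hρ : 0 ≤ ρ) (hd : 0 < d) (hg : Integrable g)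
    (hν : Continuous ν) (hu : ∀ t, u ≤ (ν t).re) (hv : ∀ t, (ν t).re ≤ v)
    (hw : ∀ t, ∀ n : ℤ, d ≤ ‖ν t - n‖) (l : ℕ) :
    Integrable fun t => (ρ : ℂ) ^ (-ν t) * gammaRatio l (ν t) * g t := by
  obtain ⟨B, -, hB⟩ := exists_norm_cpow_mul_gammaRatio_le hρ u v hd
  refine hg.bdd_mul (c := B * d⁻¹ ^ l) (Continuous.aestronglyMeasurable ?_)
    (.of_forall fun t => hB l _ (hu t) (hv t) (hw t))
  refine (hν.neg.const_cpow (Or.inr fun t => neg_ne_zero.mpr ?_)).mul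
    (continuous_gammaRatio_comp hd hν hw l)
  simpa using ne_intCast_of_le_norm_sub hd (hw t) 0

theorem integrable_cpow_mul_gammaRatio_neg_mul (hb : 0 ≤ b) (hd : 0 < d) (hg : Integrable g)
    (hν : Continuous ν) (hu : ∀ t, u ≤ (ν t).re) (hv : ∀ t, (ν t).re ≤ v)
    (hw : ∀ t, ∀ n : ℤ, d ≤ ‖ν t - n‖) (l : ℕ) :
    Integrable fun t => (b : ℂ) ^ ν t * gammaRatio l (-ν t) * g t := by
  have h := integrable_cpow_mul_gammaRatio_mul (ν := fun t => -ν t) (u := -v) (v := -u) hb hd hg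
    hν.neg (fun t => neg_le_neg (hv t)) (fun t => neg_le_neg (hu t))
    (fun t => le_norm_neg_sub (hw t)) l
  simpa only [neg_neg] using h

theorem integrable_invGaussTerm_mul (hρ : 0 ≤ ρ) (hb : 0 ≤ b) (hd : 0 < d) (hg : Integrable g)
    (hν : Continuous ν) (hu : ∀ t, u ≤ (ν t).re) (hv : ∀ t, (ν t).re ≤ v)
    (hw : ∀ t, ∀ n : ℤ, d ≤ ‖ν t - n‖) (l : ℕ) :
    Integrable fun t => invGaussTerm ρ b l (ν t) * g t := by
  refine (((integrable_cpow_mul_gammaRatio_mul hρ hd hg hν hu hv hw l).add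
    (integrable_cpow_mul_gammaRatio_neg_mul hb hd hg hν hu hv hw l)).mul_const
      ((ρ * b : ℂ) ^ l / l.factorial)).congr (.of_forall fun t => ?_)
  simp only [invGaussTerm, Pi.add_apply]
  ring

theorem exists_norm_invGaussTerm_le (hρ : 0 ≤ ρ) (hb : 0 ≤ b) (u v : ℝ) (hd : 0 < d) :
    ∃ B, ∀ (l : ℕ) (w : ℂ), u ≤ w.re → w.re ≤ v → (∀ n : ℤ, d ≤ ‖w - n‖) →
      ‖invGaussTerm ρ b l w‖ ≤ B * ((d⁻¹ * (ρ * b)) ^ l / l.factorial) := by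
  obtain ⟨B₁, h₁, hB₁⟩ := exists_norm_cpow_mul_gammaRatio_le hρ u v hd
  obtain ⟨B₂, h₂, hB₂⟩ := exists_norm_cpow_mul_gammaRatio_le hb (-v) (-u) hd
  refine ⟨B₁ + B₂, fun l w hu hv hw => ?_⟩
  have e₁ := hB₁ l w hu hv hw
  have e₂ := hB₂ l (-w) (by simpa using hv) (by simpa using hu) (le_norm_neg_sub hw)
  rw [neg_neg] at e₂
  have e₃ := (norm_add_le _ _).trans (add_le_add e₁ e₂)
  rw [invGaussTerm, norm_div, norm_mul, norm_pow, norm_mul, Complex.norm_real, Complex.norm_real,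
    Complex.norm_natCast, Real.norm_of_nonneg hρ, Real.norm_of_nonneg hb, mul_pow, mul_pow]
  calc _ ≤ (B₁ * d⁻¹ ^ l + B₂ * d⁻¹ ^ l) * (ρ ^ l * b ^ l) / l.factorial := by gcongr
    _ = _ := by ring

theorem hasSum_integral_invGaussTerm_mul (hρ : 0 < ρ) (hb : 0 < b ∨ b = 0 ∧ 0 < u) (hd : 0 < d)
    (hg : Integrable g) (hν : Continuous ν) (hu : ∀ t, u ≤ (ν t).re) (hv : ∀ t, (ν t).re ≤ v)
    (hw : ∀ t, ∀ n : ℤ, d ≤ ‖ν t - n‖) :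
    HasSum (fun l => ∫ t, invGaussTerm ρ b l (ν t) * g t)
      (∫ t, invGaussIntegral ρ b (ν t) * g t) := by
  have hb0 : 0 ≤ b := by
    rcases hb with h | h
    · exact h.le
    · exact h.1.ge
  have hi := integrable_invGaussTerm_mul hρ.le hb0 hd hg hν hu hv hw
  obtain ⟨B, hB⟩ := exists_norm_invGaussTerm_le hρ.le hb0 u v hd
  have hsum : Summable fun l => ∫ t, ‖invGaussTerm ρ b l (ν t) * g t‖ := by
    refine Summable.of_nonneg_of_le (fun l => by positivity) (fun l => ?_)
      (((Real.summable_pow_div_factorial (d⁻¹ * (ρ * b))).mul_left B).mul_right (∫ t, ‖g t‖))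
    rw [← integral_const_mul]
    refine integral_mono (hi l).norm (hg.norm.const_mul _) fun t => ?_
    simp only [norm_mul]
    exact mul_le_mul_of_nonneg_right (hB l _ (hu t) (hv t) (hw t)) (norm_nonneg _)
  have key := hasSum_integral_of_summable_integral_norm hi hsum
  suffices h : ∀ t, ∑' l, invGaussTerm ρ b l (ν t) * g t = invGaussIntegral ρ b (ν t) * g t by
    simpa only [h] using key
  intro t
  exact ((hasSum_invGaussTerm hρ (hb.imp_right fun h => ⟨h.1, h.2.trans_le (hu t)⟩) hd
    (hw t)).mul_right (g t)).tsum_eq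

end

/-! ### The path stays away from the poles -/

theorem isClosed_range_intCast_complex : IsClosed (range ((↑) : ℤ → ℂ)) := by
  have h := (Complex.isometry_ofReal.isClosedEmbedding.comp
    Int.isClosedEmbedding_coe_real).isClosed_range
  convert h using 3
  ext n
  simp

theorem exists_forall_le_of_eventually_const {f : ℝ → ℝ} (hf : Continuous f) {T : ℝ}
    (h : ∀ t, T ≤ |t| → f t = f T) : ∃ t₀, ∀ t, f t₀ ≤ f t := by
  obtain ⟨t₀, -, h₀⟩ := (isCompact_Icc (a := -|T|) (b := |T|)).exists_isMinOn
    ⟨T, neg_abs_le T, le_abs_self T⟩ hf.continuousOn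
  refine ⟨t₀, fun t => ?_⟩
  rcases le_total T |t| with ht | ht
  · rw [h t ht]
    exact h₀ ⟨neg_abs_le T, le_abs_self T⟩
  · exact h₀ (abs_le.mp (ht.trans (le_abs_self T)))

theorem exists_le_norm_sub_intCast {ν : ℝ → ℂ} (hν : Continuous ν) (h : ∀ t, ∀ n : ℤ, ν t ≠ n)
    (T : ℝ) : ∃ d, 0 < d ∧ ∀ t, |t| ≤ T → ∀ n : ℤ, d ≤ ‖ν t - n‖ := by
  rcases lt_or_ge T 0 with hT | hT
  · exact ⟨1, one_pos, fun t ht => absurd ((abs_nonneg t).trans ht) (not_le.mpr hT)⟩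
  obtain ⟨t₀, -, h₀⟩ := (isCompact_Icc (a := -T) (b := T)).exists_isMinOn
    ⟨0, by simpa using hT, hT⟩
    ((Metric.continuous_infDist_pt (range ((↑) : ℤ → ℂ))).comp hν).continuousOn
  refine ⟨Metric.infDist (ν t₀) (range ((↑) : ℤ → ℂ)), ?_, fun t ht n => ?_⟩
  · refine (isClosed_range_intCast_complex.notMem_iff_infDist_pos (range_nonempty _)).mp ?_
    rintro ⟨n, hn⟩
    exact h t₀ n hn.symm
  · rw [← dist_eq_norm]
    exact (h₀ (abs_le.mp ht)).trans (Metric.infDist_le_dist_of_mem (mem_range_self n))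

theorem MBPath.continuous (C : MBPath) : Continuous C.toFun :=
  let ⟨_, h⟩ := C.lipschitz
  h.continuous

theorem MBPath.IsLeft.ne {C : MBPath} {s : ℂ} (h : C.IsLeft s) (t : ℝ) : C.toFun t ≠ s := by
  rintro rfl
  obtain ⟨s', -, h⟩ := h
  exact h.source_mem (mem_range_self t)

theorem MBPath.IsRight.ne {C : MBPath} {s : ℂ} (h : C.IsRight s) (t : ℝ) : C.toFun t ≠ s := by
  rintro rfl
  obtain ⟨s', -, h⟩ := h
  exact h.source_mem (mem_range_self t)

theorem gammaPow_one (z : ℂ) : gammaPow 1 z = Complex.Gamma z := by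
  rw [gammaPow, if_pos ⟨1, by simp⟩]
  simp

theorem mem_gammaPowSing_one {z : ℂ} : z ∈ gammaPowSing 1 ↔ ∃ k : ℕ, z = -(k : ℂ) := by
  rw [gammaPowSing, if_pos ⟨1, by simp⟩]
  rfl

section

variable {P : IParams} {C : MBPath} {α σ : ℝ}

/-- The added numerator factors are `Γ(w)`, with poles at `0, -1, -2, …`, and `Γ(1-w)`, with poles
at `1, 2, …`. Together these are all the integers, and no pole lies on the path. -/
theorem ne_intCast_of_separates_first (h : (P.first α σ 0).Separates C) (t : ℝ) (n : ℤ) :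
    (α : ℂ) - σ * C.toFun t ≠ n := by
  intro hn
  rcases le_total n 0 with h0 | h0
  · obtain ⟨k, hk⟩ := Int.eq_ofNat_of_zero_le (neg_nonneg.mpr h0)
    refine (h.right ⟨1 - α, σ, 1⟩ (by simp [IParams.first]) (C.toFun t) ?_).ne t rfl
    rw [mem_gammaPowSing_one]
    refine ⟨k, ?_⟩
    have : (n : ℂ) = -(k : ℂ) := by
      rw [← neg_eq_iff_eq_neg]
      exact_mod_cast hk
    rw [← this, ← hn]
    ring
  · rcases h0.eq_or_lt with rfl | h1
    · refine (h.right ⟨1 - α, σ, 1⟩ (by simp [IParams.first]) (C.toFun t) ?_).ne t rfl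
      rw [mem_gammaPowSing_one]
      refine ⟨0, ?_⟩
      simp only [Int.cast_zero] at hn
      simp only [Nat.cast_zero, neg_zero]
      linear_combination hn
    · obtain ⟨k, hk⟩ := Int.eq_ofNat_of_zero_le (sub_nonneg.mpr (Int.add_one_le_of_lt h1))
      refine (h.left ⟨1 - α, σ, 1⟩ (by simp [IParams.first]) (C.toFun t) ?_).ne t rfl
      rw [mem_gammaPowSing_one]
      refine ⟨k, ?_⟩
      have : (n : ℂ) - (0 + 1) = (k : ℂ) := by exact_mod_cast hk
      rw [← this, ← hn]
      ring

/-- On a compact piece of the path the distance to the closed set of integers attains a positive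
minimum; on the tails the imaginary part of `w` suffices. If `σ = 0`, then `w` is constant. -/
theorem exists_le_norm_sub_of_separates_first (h : (P.first α σ 0).Separates C) (hσ : 0 ≤ σ) :
    ∃ d, 0 < d ∧ ∀ t, ∀ n : ℤ, d ≤ ‖(α : ℂ) - σ * C.toFun t - n‖ := by
  obtain ⟨T, hT⟩ := C.tails
  obtain ⟨d, hd, hdn⟩ := exists_le_norm_sub_intCast
    (continuous_const.sub (continuous_const.mul C.continuous))
    (ne_intCast_of_separates_first h) (max T 1)
  rcases hσ.eq_or_lt with rfl | hσ
  · refine ⟨d, hd, fun t n => ?_⟩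
    simpa using hdn 0 (by simp) n
  · refine ⟨min d σ, lt_min hd hσ, fun t n => ?_⟩
    rcases le_total |t| (max T 1) with ht | ht
    · exact (min_le_left _ _).trans (hdn t ht n)
    -- On the tail `|Im w| = σ |t|`, and `|t| ≥ 1` by the choice of `max T 1`.
    · refine (min_le_right _ _).trans (le_trans ?_ (Complex.abs_im_le_norm _))
      rw [hT t ((le_max_left _ _).trans ht)]
      have him : ((α : ℂ) - σ * (C.c + t * Complex.I) - n).im = -(σ * t) := by simp
      rw [him, abs_neg, abs_mul, abs_of_pos hσ]
      exact le_mul_of_one_le_right hσ.le ((le_max_right _ _).trans ht)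

/-- The lower bound is attained at a point of the path, so pointwise positivity of `Re w`, as
required for `b = 0`, becomes uniform. -/
theorem exists_re_bounds (C : MBPath) (α σ : ℝ) :
    (∃ t₀, ∀ t, ((α : ℂ) - σ * C.toFun t₀).re ≤ ((α : ℂ) - σ * C.toFun t).re) ∧
      ∃ v, ∀ t, ((α : ℂ) - σ * C.toFun t).re ≤ v := by
  obtain ⟨T, hT⟩ := C.tails
  have hc : Continuous fun t => ((α : ℂ) - σ * C.toFun t).re :=
    Complex.continuous_re.comp (continuous_const.sub (continuous_const.mul C.continuous))
  have htail : ∀ t, |T| ≤ |t| →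
      ((α : ℂ) - σ * C.toFun t).re = ((α : ℂ) - σ * C.toFun |T|).re := fun t ht => by
    rw [hT t ((le_abs_self T).trans ht), hT |T| ((le_abs_self T).trans (le_abs_self _))]
    simp
  refine ⟨exists_forall_le_of_eventually_const hc htail, ?_⟩
  obtain ⟨t₁, h₁⟩ := exists_forall_le_of_eventually_const hc.neg (T := |T|)
    fun t ht => congrArg Neg.neg (htail t ht)
  exact ⟨_, fun t => neg_le_neg_iff.mp (h₁ t)⟩

/-! ### Matching with the enlarged Mellin–Barnes kernels -/

/-- Because `n ≤ p`, the triple appended to the upper row falls in the denominator and the one in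
front in the numerator. -/
theorem IParams.chi_first (hP : P.Valid) (l : ℕ) (s : ℂ) :
    (P.first α σ l).chi s = gammaRatio l (α - σ * s) * P.chi s := by
  simp only [IParams.chi, IParams.first, List.take_succ_cons, List.drop_succ_cons, List.map_cons,
    List.prod_cons, List.take_append_of_le_length hP.n_le, List.drop_append_of_le_length hP.n_le,
    List.map_append, List.prod_append, List.map_nil, List.prod_nil, mul_one, gammaPow_one,
    gammaRatio]
  rw [show 1 - (1 - α : ℂ) - σ * s = α - σ * s by ring,
    show (1 - α : ℂ) + σ * s = 1 - (α - σ * s) by ring,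
    show 1 + l - (α : ℂ) + σ * s = 1 + l - (α - σ * s) by ring, ← mul_div_mul_comm]
  congr 1 <;> ring

/-- The minus sign comes from `Γ(w) Γ(1-w) = -Γ(-w) Γ(1+w)`, the functional equation used twice; it
is the minus sign between the two `I`-functions. -/
theorem IParams.chi_second (hP : P.Valid) (l : ℕ) {s : ℂ} (hs : (α : ℂ) - σ * s ≠ 0) :
    (P.second α σ l).chi s = -gammaRatio l (-(α - σ * s)) * P.chi s := by
  have h1 := Complex.Gamma_add_one _ hs
  have h2 := Complex.Gamma_add_one _ (neg_ne_zero.mpr hs)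
  simp only [IParams.chi, IParams.second, List.take_succ_cons, List.drop_succ_cons, List.map_cons,
    List.prod_cons, List.take_append_of_le_length hP.m_le, List.drop_append_of_le_length hP.m_le,
    List.map_append, List.prod_append, List.map_nil, List.prod_nil, mul_one, gammaPow_one,
    gammaRatio]
  rw [show 1 - (1 - α : ℂ) - σ * s = α - σ * s by ring,
    show (1 - α : ℂ) + σ * s = -(α - σ * s) + 1 by ring,
    show 1 - (-l - α : ℂ) - σ * s = 1 + l - -(α - σ * s) by ring,
    show 1 - -(α - σ * s) = (α - σ * s) + 1 by ring, h1, h2, ← neg_div, ← mul_div_mul_comm]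
  congr 1 <;> ring

/-- A positive real factor leaves the argument of `δ` unchanged, so the principal power is
multiplicative here. -/
theorem mul_rpow_cpow_neg {δ : ℂ} (hδ : δ ≠ 0) {x : ℝ} (hx : 0 < x) (σ : ℝ) (s : ℂ) :
    (δ * ((x ^ σ : ℝ) : ℂ)) ^ (-s) = (x : ℂ) ^ (-(σ * s)) * δ ^ (-s) := by
  have hxσ : 0 < x ^ σ := Real.rpow_pos_of_pos hx σ
  have hx0 : (x : ℂ) ≠ 0 := by exact_mod_cast hx.ne'
  have hxσ0 : ((x ^ σ : ℝ) : ℂ) ≠ 0 := by exact_mod_cast hxσ.ne'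
  rw [Complex.cpow_def_of_ne_zero (mul_ne_zero hδ hxσ0), Complex.cpow_def_of_ne_zero hx0,
    Complex.cpow_def_of_ne_zero hδ, mul_comm δ, Complex.log_ofReal_mul hxσ hδ, Real.log_rpow hx,
    ← Complex.exp_add, Complex.ofReal_mul, Complex.ofReal_log hx.le]
  congr 1
  ring

theorem IParams.integrand_mul_rpow {δ : ℂ} (hδ : δ ≠ 0) {x : ℝ} (hx : 0 < x) (t : ℝ) :
    P.integrand C (δ * (x ^ σ : ℝ)) t =
      (x : ℂ) ^ (-(σ * C.toFun t)) * P.integrand C δ t := by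
  simp only [IParams.integrand, mul_rpow_cpow_neg hδ hx]
  ring

theorem ofReal_rpow_mul_cpow {x : ℝ} (hx : 0 < x) (y : ℝ) (z : ℂ) :
    ((x ^ y : ℝ) : ℂ) * (x : ℂ) ^ z = (x : ℂ) ^ (y + z) := by
  rw [Complex.ofReal_cpow hx.le, Complex.cpow_add _ _ (by exact_mod_cast hx.ne')]

theorem IParams.integrand_first (hP : P.Valid) {δ : ℂ} (hδ : δ ≠ 0) {ρ : ℝ} (hρ : 0 < ρ) (l : ℕ)
    (t : ℝ) : (P.first α σ l).integrand C (δ / (ρ ^ σ : ℝ)) t =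
      (ρ ^ α : ℝ) * ((ρ : ℂ) ^ (-((α : ℂ) - σ * C.toFun t)) *
        gammaRatio l (α - σ * C.toFun t) * P.integrand C δ t) := by
  have h : δ / (ρ ^ σ : ℝ) = δ * ((ρ ^ (-σ) : ℝ) : ℂ) := by
    rw [Real.rpow_neg hρ.le, div_eq_mul_inv, Complex.ofReal_inv]
  have h2 := ofReal_rpow_mul_cpow hρ α (-((α : ℂ) - σ * C.toFun t))
  rw [← sub_eq_add_neg, sub_sub_cancel] at h2
  rw [h, IParams.integrand_mul_rpow hδ hρ, IParams.integrand, IParams.integrand,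
    IParams.chi_first hP, Complex.ofReal_neg, neg_mul, neg_neg, ← h2]
  ring

theorem IParams.ofReal_rpow_mul_integrand_second (hP : P.Valid) {δ : ℂ} (hδ : δ ≠ 0) {b : ℝ}
    (hb : 0 < b) (l : ℕ) {t : ℝ} (ht : (α : ℂ) - σ * C.toFun t ≠ 0) :
    (b ^ α : ℝ) * (P.second α σ l).integrand C ((b ^ σ : ℝ) * δ) t =
      -((b : ℂ) ^ ((α : ℂ) - σ * C.toFun t) *
        gammaRatio l (-(α - σ * C.toFun t)) * P.integrand C δ t) := by
  have h2 := ofReal_rpow_mul_cpow hb α (-(σ * C.toFun t))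
  rw [mul_comm _ δ, IParams.integrand_mul_rpow hδ hb, IParams.integrand, IParams.integrand,
    IParams.chi_second hP l ht, sub_eq_add_neg (α : ℂ) (σ * C.toFun t), ← h2]
  ring

theorem ofReal_exp_mul_density {f : ℝ → ℝ} {k₂ δ : ℂ} {a b : ℝ}
    (hf : IsIFIGDensity f k₂ α a b δ σ P C) (r : ℝ) {x : ℝ} (hx : 0 < x) :
    ((Real.exp (-r * x) * f x : ℝ) : ℂ) = k₂ * (1 / (2 * Real.pi * Complex.I)) *
      ∫ t, mellinBarnesKernel (a + r) b (P.integrand C δ)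
        (fun t => (α : ℂ) - σ * C.toFun t) x t := by
  have hE : Real.exp (-(a + r) * x - b * x⁻¹) =
      Real.exp (-r * x) * Real.exp (-a * x - b * x⁻¹) := by
    rw [← Real.exp_add]
    congr 1
    ring
  have hk : ∀ t, mellinBarnesKernel (a + r) b (P.integrand C δ)
      (fun t => (α : ℂ) - σ * C.toFun t) x t =
      ((x ^ (α - 1) : ℝ) * (Real.exp (-(a + r) * x - b * x⁻¹) : ℝ)) *
        P.integrand C (δ * (x ^ σ : ℝ)) t := fun t => by
    have h2 := ofReal_rpow_mul_cpow hx (α - 1) (-(σ * C.toFun t))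
    rw [Complex.ofReal_sub, Complex.ofReal_one] at h2
    rw [mellinBarnesKernel, IParams.integrand_mul_rpow hf.delta_ne_zero hx,
      show (α : ℂ) - σ * C.toFun t - 1 = α - 1 + -(σ * C.toFun t) by ring, ← h2]
    ring
  simp only [hk]
  rw [integral_const_mul, hE]
  push_cast
  rw [hf.eq_of_pos x hx, IParams.I]
  push_cast
  ring

end

theorem IsIFIGDensity.pos_or_eq_zero {f : ℝ → ℝ} {k₂ δ : ℂ} {α a b σ : ℝ} {P : IParams}
    {C : MBPath} (hf : IsIFIGDensity f k₂ α a b δ σ P C) : 0 < b ∨ b = 0 ∧ 0 < α := by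
  rcases lt_trichotomy α 0 with h | h | h
  · exact Or.inl (hf.neg_case h).2
  · exact Or.inl (hf.zero_case h).2
  · exact (hf.pos_case h).2.lt_or_eq.imp_right fun h' => ⟨h'.symm, h⟩

end

theorem corollary5p3 (f : ℝ → ℝ) (k₂ : ℂ) (α a b : ℝ) (δ : ℂ) (σ : ℝ) (P : IParams) (C : MBPath)
    (hf : IsIFIGDensity f k₂ α a b δ σ P C) (r : ℝ) (hr : 0 < a + r)
    (hfirst : ∀ l : ℕ, (P.first α σ l).Separates C)
    (hsecond : ∀ l : ℕ, (P.second α σ l).Separates C)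
    (hb : b = 0 → ∀ t : ℝ, 0 < ((α : ℂ) - σ * C.toFun t).re) :
    IntegrableOn (fun x => Real.exp (-r * x) * f x) (Ioi 0) ∧
    (∀ l : ℕ, (P.first α σ l).AbsConv C (δ / ((a + r) ^ σ : ℝ))) ∧
    (b ≠ 0 → ∀ l : ℕ, (P.second α σ l).AbsConv C ((b ^ σ : ℝ) * δ)) ∧
    Summable (laplaceTerm α a b δ σ P C r) ∧
    (laplaceTransform f r : ℂ) = k₂ * ∑' l : ℕ, laplaceTerm α a b δ σ P C r l := by
  have hδ := hf.delta_ne_zero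
  have hP := hf.valid
  obtain ⟨d, hd, hw⟩ := exists_le_norm_sub_of_separates_first (hfirst 0) hf.sigma_nonneg
  obtain ⟨⟨t₀, hu⟩, v, hv⟩ := exists_re_bounds C α σ
  have hν : Continuous fun t => (α : ℂ) - σ * C.toFun t :=
    continuous_const.sub (continuous_const.mul C.continuous)
  have hν0 : ∀ t, (α : ℂ) - σ * C.toFun t ≠ 0 := fun t => by
    simpa using ne_intCast_of_le_norm_sub hd (hw t) 0
  -- At `x = 1` the argument `δ x^σ` is `δ` itself.
  have hg : Integrable (P.integrand C δ) := by simpa [IParams.AbsConv] using hf.absConv 1 one_pos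
  have hbα := hf.pos_or_eq_zero
  have hb0 : 0 ≤ b := hbα.elim le_of_lt fun h => h.1.ge
  have hb' : 0 < b ∨ b = 0 ∧ 0 < ((α : ℂ) - σ * C.toFun t₀).re :=
    hbα.imp_right fun h => ⟨h.1, hb h.1 t₀⟩
  have hi₁ := integrable_cpow_mul_gammaRatio_mul hr.le hd hg hν hu hv hw
  have hi₂ := integrable_cpow_mul_gammaRatio_neg_mul hb0 hd hg hν hu hv hw
  have hterm : ∀ l, laplaceTerm α a b δ σ P C r l = 1 / (2 * Real.pi * Complex.I) *
      ∫ t, invGaussTerm (a + r) b l ((α : ℂ) - σ * C.toFun t) * P.integrand C δ t := by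
    intro l
    have hρα : (((a + r) ^ α : ℝ) : ℂ) ≠ 0 := by
      exact_mod_cast (Real.rpow_pos_of_pos hr α).ne'
    have h₁ : (1 / ((a + r) ^ α : ℝ) : ℂ) *
        ∫ t, (P.first α σ l).integrand C (δ / ((a + r) ^ σ : ℝ)) t =
        ∫ t, ((a + r : ℝ) : ℂ) ^ (-((α : ℂ) - σ * C.toFun t)) *
          gammaRatio l (α - σ * C.toFun t) * P.integrand C δ t := by
      simp only [IParams.integrand_first hP hδ hr, integral_const_mul]
      rw [← mul_assoc, one_div_mul_cancel hρα, one_mul]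
    have h₂ : ((b ^ α : ℝ) : ℂ) * ∫ t, (P.second α σ l).integrand C ((b ^ σ : ℝ) * δ) t =
        -∫ t, (b : ℂ) ^ ((α : ℂ) - σ * C.toFun t) *
          gammaRatio l (-(α - σ * C.toFun t)) * P.integrand C δ t := by
      rcases hbα with h | ⟨rfl, h⟩
      · rw [← integral_const_mul, ← integral_neg]
        simp only [IParams.ofReal_rpow_mul_integrand_second hP hδ h l (hν0 _)]
      -- For `b = 0` both sides vanish: `0^α = 0` since `α > 0`, and `0^w = 0` since `w ≠ 0`.
      · simp [Real.zero_rpow h.ne', Complex.zero_cpow (hν0 _)]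
    have h₃ : ∫ t, invGaussTerm (a + r) b l ((α : ℂ) - σ * C.toFun t) * P.integrand C δ t =
        ((∫ t, ((a + r : ℝ) : ℂ) ^ (-((α : ℂ) - σ * C.toFun t)) *
          gammaRatio l (α - σ * C.toFun t) * P.integrand C δ t) +
        ∫ t, (b : ℂ) ^ ((α : ℂ) - σ * C.toFun t) *
          gammaRatio l (-(α - σ * C.toFun t)) * P.integrand C δ t) *
        ((((a + r) * b : ℝ) : ℂ) ^ l / (l.factorial : ℂ)) := by
      rw [← integral_add (hi₁ l) (hi₂ l), ← integral_mul_const]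
      refine integral_congr_ae (.of_forall fun t => ?_)
      simp only [invGaussTerm, Complex.ofReal_mul]
      ring
    rw [h₃, laplaceTerm, IParams.I, IParams.I]
    linear_combination (1 / (2 * Real.pi * Complex.I) *
      ((((a + r) * b : ℝ) : ℂ) ^ l / (l.factorial : ℂ))) * (h₁ - h₂)
  have hsum := (hasSum_integral_invGaussTerm_mul hr hb' hd hg hν hu hv hw).mul_left
    (1 / (2 * Real.pi * Complex.I))
  simp only [← hterm] at hsum
  have hdens : EqOn (fun x => ((Real.exp (-r * x) * f x : ℝ) : ℂ))
      (fun x => k₂ * (1 / (2 * Real.pi * Complex.I)) *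
        ∫ t, mellinBarnesKernel (a + r) b (P.integrand C δ)
          (fun t => (α : ℂ) - σ * C.toFun t) x t) (Ioi 0) :=
    fun x hx => ofReal_exp_mul_density hf r hx
  refine ⟨?_, fun l => ?_, fun hbne l => ?_, hsum.summable, ?_⟩
  -- Integrability in `x` is the Fubini marginal of the integrable double kernel.
  · have h := (integrable_mellinBarnesKernel hr hb' hg hν hu hv).integral_prod_left.const_mul
      (k₂ * (1 / (2 * Real.pi * Complex.I)))
    have h' : IntegrableOn (fun x => ((Real.exp (-r * x) * f x : ℝ) : ℂ)) (Ioi 0) :=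
      IntegrableOn.congr_fun h hdens.symm measurableSet_Ioi
    exact h'.re
  · exact ((hi₁ l).const_mul _).congr
      (.of_forall fun t => (IParams.integrand_first hP hδ hr l t).symm)
  · have hbpos := hb0.lt_of_ne' hbne
    have hbα0 : ((b ^ α : ℝ) : ℂ) ≠ 0 := by
      exact_mod_cast (Real.rpow_pos_of_pos hbpos α).ne'
    refine ((hi₂ l).neg.const_mul ((b ^ α : ℝ) : ℂ)⁻¹).congr (.of_forall fun t => ?_)
    have h := IParams.ofReal_rpow_mul_integrand_second hP hδ hbpos l (hν0 t)
    simp only [Pi.neg_apply]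
    rw [← h, inv_mul_cancel_left₀ hbα0]
  · rw [laplaceTransform, ← integral_complex_ofReal, setIntegral_congr_fun measurableSet_Ioi hdens,
      integral_const_mul, integral_mellinBarnesKernel hr hb' hg hν hu hv, hsum.tsum_eq]
    ring
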